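/- **Theorem.** Every retract of a Valdivia compact space belongs to class $\mathcal R$. That is: if $Y$ is a Valdivia compact space and $f\colon Y\to X$ is a continuous map onto a topological space $X$ that has a continuous right inverse $g\colon X\to Y$ (so $f\circ g=\mathrm{id}_X$), then $X\in\mathcal R$. Here a compact space $Y$ is *Valdivia compact* if for some set $\kappa$ there is a topological embedding $e\colon Y\to[0,1]^\kappa$ such that $e(Y)$ is the closure of $e(Y)\cap\Sigma(\kappa)$, where $\Sigma(\kappa)=\{x\in[0,1]^\kappa : x(\alpha)\neq 0 \text{ for at most countably many } \alpha\in\kappa\}$. A *retraction* is a continuous map that has a continuous right inverse. An *inverse sequence* is an inverse system $\langle X_\xi, p_\xi^\eta\rangle_{\xi\le\eta<\lambda}$ of topological spaces and continuous bonding maps $p_\xi^\eta\colon X_\eta\to X_\xi$ indexed by an ordinal $\lambda$; it is *continuous* if for every limit ordinal $\delta<\lambda$ the space $X_\delta$ together with the maps $p_\xi^\delta$ ($\xi<\delta$) is the limit of the restricted sequence $\langle X_\xi,p_\xi^\eta\rangle_{\xi\le\eta<\delta}$. The class $\mathcal R$ is the smallest class of compact spaces that contains all compact metrizable spaces and that contains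 the limit of every continuous inverse sequence of members of the class all of whose bonding maps are retractions. -/

import Mathlib

universe u v

/-- A retraction in the sense of a right-invertible map: a continuous map `f : X → Y` for which
there is a continuous map `g : Y → X` with `f ∘ g = id`. -/
def IsRetractionMap {X : Type u} {Y : Type v} [TopologicalSpace X] [TopologicalSpace Y]
    (f : X → Y) : Prop :=
  Continuous f ∧ ∃ g : Y → X, Continuous g ∧ ∀ y, f (g y) = y

/-- The `Σ`-product of `κ` copies of the unit interval: the points of the cube `[0,1]^κ` whose
support is countable. -/
def sigmaProduct (κ : Type u) : Set (κ → unitInterval) :=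
  {x | {α | x α ≠ 0}.Countable}

/-- Valdivia compact spaces: compact spaces that can be embedded into some cube `[0,1]^κ` so that
the image is the closure of its intersection with the `Σ`-product. -/
def IsValdiviaCompact (X : Type u) [TopologicalSpace X] : Prop :=
  CompactSpace X ∧ ∃ (κ : Type u) (e : X → κ → unitInterval), Topology.IsEmbedding e ∧
    Set.range e = closure (Set.range e ∩ sigmaProduct κ)

/-- An inverse system of topological spaces and continuous bonding maps indexed by `ι`. -/
structure TopInverseSystem (ι : Type v) [Preorder ι] where
  /-- The spaces of the system. -/
  space : ι → Type u
  /-- Their topologies. -/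
  [top : ∀ i, TopologicalSpace (space i)]
  /-- The bonding maps. -/
  bond : ∀ ⦃i j : ι⦄, i ≤ j → space j → space i
  continuous_bond : ∀ ⦃i j : ι⦄ (h : i ≤ j), Continuous (bond h)
  bond_self : ∀ (i : ι) (x : space i), bond (le_refl i) x = x
  bond_bond : ∀ ⦃i j k : ι⦄ (hij : i ≤ j) (hjk : j ≤ k) (x : space k),
    bond hij (bond hjk x) = bond (hij.trans hjk) x

attribute [instance] TopInverseSystem.top

namespace TopInverseSystem

section Limits

variable {ι : Type v} [Preorder ι] (S : TopInverseSystem.{u, v} ι)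

/-- The inverse limit of the system, as a subspace of the product of its spaces. -/
def Limit : Type (max u v) :=
  {x : ∀ i, S.space i // ∀ ⦃i j : ι⦄ (h : i ≤ j), S.bond h (x j) = x i}

instance : TopologicalSpace S.Limit :=
  inferInstanceAs (TopologicalSpace
    {x : ∀ i, S.space i // ∀ ⦃i j : ι⦄ (h : i ≤ j), S.bond h (x j) = x i})

/-- The map into the inverse limit induced by a compatible family of maps. -/
def lift {X : Type u} (p : ∀ i, X → S.space i)
    (hp : ∀ ⦃i j : ι⦄ (h : i ≤ j) (x : X), S.bond h (p j x) = p i x) : X → S.Limit :=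
  fun x => ⟨fun i => p i x, fun _ _ h => hp h x⟩

/-- The space `X` with the projections `p i : X → S.space i` is the limit of the system: the
projections are compatible with the bonding maps, and the induced map of `X` into the inverse limit
is a homeomorphism. -/
def IsLimitCone {X : Type u} [TopologicalSpace X] (p : ∀ i, X → S.space i) : Prop :=
  ∃ hp : ∀ ⦃i j : ι⦄ (h : i ≤ j) (x : X), S.bond h (p j x) = p i x, IsHomeomorph (S.lift p hp)

/-- The restriction of the system to the indices below `δ`. -/
def restrictIio (δ : ι) : TopInverseSystem.{u, v} (Set.Iio δ) where
  space i := S.space i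
  bond _ _ h := S.bond h
  continuous_bond _ _ h := S.continuous_bond h
  bond_self i x := S.bond_self i x
  bond_bond _ _ _ hij hjk x := S.bond_bond hij hjk x

/-- Continuity of an inverse sequence: at each limit index `δ`, the space with index `δ` together
with the bonding maps to the earlier spaces is the limit of the restriction of the sequence to the
indices below `δ`. -/
def IsContinuousSeq : Prop :=
  ∀ δ : ι, Order.IsSuccLimit δ →
    (S.restrictIio δ).IsLimitCone fun i : Set.Iio δ => S.bond (le_of_lt i.2)

end Limits

end TopInverseSystem

/-- The class `R`: the smallest class of spaces that contains all compact metrizable spaces and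
that contains, with all the spaces of a continuous inverse sequence whose bonding maps are
retractions, the limit of this sequence. Sequences of ordinal length are those indexed by
well-ordered sets. -/
inductive IsClassR : ∀ (X : Type u) [TopologicalSpace X], Prop
  | of_metrizable (X : Type u) [TopologicalSpace X] [CompactSpace X]
      [TopologicalSpace.MetrizableSpace X] : IsClassR X
  | of_limit (ι : Type u) [LinearOrder ι] [WellFoundedLT ι] (S : TopInverseSystem.{u, u} ι)
      (hcont : S.IsContinuousSeq)
      (hretr : ∀ ⦃i j : ι⦄ (h : i ≤ j), IsRetractionMap (S.bond h))
      (hmem : ∀ i, IsClassR (S.space i))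
      (X : Type u) [TopologicalSpace X] (p : ∀ i, X → S.space i)
      (hp : S.IsLimitCone p) : IsClassR X

/-! Embed `X` in the cube by `h = e ∘ g`, and for a set `A` of coordinates let `X_A` be the image of
`h` with the coordinates outside `A` set to zero. Call `A` good if zeroing outside `A` maps `e(Y)`
into itself and each coordinate `a ∈ A` of `h ∘ f` depends only on the coordinates of `e` in `A`.
For good `A`, every point of `X_A` lies in `e(Y)`, and `f ∘ e⁻¹` is a right inverse of `X → X_A`.
Closure under a suitable finitary operation with countable values makes `A` good
(`exists_finClosed_indicator_mem`, `exists_countable_dependsOn`). An uncountable closed set is an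
increasing union of smaller closed sets, continuous at limits, so induction on `#A` puts `X_A` in
class `R` (`isClassR_coordImage`). The full coordinate set gives `X`. -/

open Set Cardinal Topology

/-! ### Closure under finitary operations with countable values -/

section FinitaryClosure

variable {κ : Type u}

/-- A set `A` is closed under the finitary set-valued operation `C` if it contains `C F` for every
finite `F ⊆ A`. -/
def IsFinClosed (C : Finset κ → Set κ) (A : Set κ) : Prop :=
  ∀ F : Finset κ, (F : Set κ) ⊆ A → C F ⊆ A

/-- One step of closing a set under a finitary set-valued operation. -/
def finClosureStep (C : Finset κ → Set κ) (S : Set κ) : Set κ :=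
  S ∪ ⋃ F : Finset S, C (F.map (Function.Embedding.subtype (· ∈ S)))

/-- The closure of a set under a finitary set-valued operation. -/
def finClosure (C : Finset κ → Set κ) (S : Set κ) : Set κ :=
  ⋃ n : ℕ, (finClosureStep C)^[n] S

variable {C : Finset κ → Set κ} {S A : Set κ}

theorem subset_finClosureStep : S ⊆ finClosureStep C S := subset_union_left

theorem apply_subset_finClosureStep {F : Finset κ} (hF : (F : Set κ) ⊆ S) :
    C F ⊆ finClosureStep C S := by
  classical
  refine subset_union_of_subset_right (subset_iUnion_of_subset (F.subtype (· ∈ S)) ?_) _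
  rw [Finset.subtype_map_of_mem fun x hx => hF hx]

theorem finClosureStep_subset (hA : IsFinClosed C A) (h : S ⊆ A) : finClosureStep C S ⊆ A := by
  refine union_subset h (iUnion_subset fun F => hA _ fun x hx => ?_)
  obtain ⟨y, -, rfl⟩ := Finset.mem_map.1 (Finset.mem_coe.1 hx)
  exact h y.2

theorem subset_finClosure : S ⊆ finClosure C S :=
  subset_iUnion_of_subset 0 subset_rfl

theorem finClosure_subset (hA : IsFinClosed C A) (h : S ⊆ A) : finClosure C S ⊆ A := by
  refine iUnion_subset fun n => ?_
  induction n with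
  | zero => exact h
  | succ n ih =>
    rw [Function.iterate_succ_apply']
    exact finClosureStep_subset hA ih

/-- The union of a directed family of closed sets is closed. -/
theorem IsFinClosed.iUnion_of_directed {ι : Type*} [Nonempty ι] {B : ι → Set κ}
    (hd : Directed (· ⊆ ·) B) (hB : ∀ i, IsFinClosed C (B i)) : IsFinClosed C (⋃ i, B i) := by
  intro F hF
  obtain ⟨i, hi⟩ := hd.exists_mem_subset_of_finset_subset_biUnion hF
  exact (hB i F hi).trans (subset_iUnion B i)

theorem isFinClosed_finClosure (C : Finset κ → Set κ) (S : Set κ) :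
    IsFinClosed C (finClosure C S) := by
  intro F hF
  have hmono : Monotone fun n : ℕ => (finClosureStep C)^[n] S := monotone_nat_of_le_succ fun n => by
    rw [Function.iterate_succ_apply']
    exact subset_finClosureStep
  obtain ⟨n, hn⟩ := hmono.directed_le.exists_mem_subset_of_finset_subset_biUnion hF
  refine (apply_subset_finClosureStep hn).trans (subset_iUnion_of_subset (n + 1) ?_)
  rw [Function.iterate_succ_apply']

theorem finClosure_mono {T : Set κ} (h : S ⊆ T) : finClosure C S ⊆ finClosure C T :=
  finClosure_subset (isFinClosed_finClosure C T) (h.trans subset_finClosure)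

/-- A set of size at most an infinite `c` has at most `c` finite subsets, and each contributes
countably many points. -/
theorem mk_finClosureStep_le (hC : ∀ F, (C F).Countable) {c : Cardinal.{u}} (hc : ℵ₀ ≤ c)
    (hS : #S ≤ c) : #(finClosureStep C S) ≤ c := by
  classical
  have hfin : #(Finset S) ≤ c := by
    have h := mk_le_of_surjective (List.toFinset_surjective (α := S))
    exact h.trans ((mk_list_le_max S).trans (max_le hc hS))
  refine (mk_union_le _ _).trans (add_le_of_le hc hS ((mk_iUnion_le _).trans ?_))
  refine mul_le_of_le hc hfin (ciSup_le' fun F => ?_)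
  exact ((hC _).le_aleph0).trans hc

theorem mk_finClosure_le (hC : ∀ F, (C F).Countable) {c : Cardinal.{u}} (hc : ℵ₀ ≤ c)
    (hS : #S ≤ c) : #(finClosure C S) ≤ c := by
  have hn : ∀ n : ℕ, #((finClosureStep C)^[n] S : Set κ) ≤ c := fun n => by
    induction n with
    | zero => exact hS
    | succ n ih =>
      rw [Function.iterate_succ_apply']
      exact mk_finClosureStep_le hC hc ih
  have h := mk_iUnion_le_lift fun n : ℕ => (finClosureStep C)^[n] S
  simp only [lift_uzero, mk_nat, lift_aleph0] at h
  exact h.trans (mul_le_of_le hc hc (ciSup_le' hn))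

end FinitaryClosure

/-! ### Images in subcubes and their inverse limits -/

section CoordinateRestriction

variable {κ : Type u} {X : Type u}

theorem continuous_indicator_coord (A : Set κ) :
    Continuous fun x : κ → unitInterval => A.indicator x := by
  refine continuous_pi fun a => ?_
  by_cases ha : a ∈ A
  · simpa [ha] using continuous_apply a
  · simpa [ha] using continuous_const

/-- The image of `h : X → [0,1]^κ` after all coordinates outside of `A` have been set to zero. -/
abbrev CoordImage (h : X → κ → unitInterval) (A : Set κ) : Type u :=
  range fun x => A.indicator (h x)

/-- The map of a space onto its image in the cube with coordinates in `A`. -/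
noncomputable def toCoordImage (h : X → κ → unitInterval) (A : Set κ) : X → CoordImage h A :=
  rangeFactorization fun x => A.indicator (h x)

/-- The projection of the `A`-image onto the `B`-image, for `B ⊆ A`. -/
noncomputable def CoordImage.proj (h : X → κ → unitInterval) {A B : Set κ} (hBA : B ⊆ A) :
    CoordImage h A → CoordImage h B :=
  fun y => ⟨B.indicator y.1, by
    obtain ⟨_, x, rfl⟩ := y
    exact ⟨x, by simp [indicator_indicator, inter_eq_left.2 hBA]⟩⟩

variable {h : X → κ → unitInterval} {A B : Set κ}

theorem toCoordImage_surjective : Function.Surjective (toCoordImage h A) :=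
  rangeFactorization_surjective

theorem CoordImage.continuous_proj (hBA : B ⊆ A) : Continuous (CoordImage.proj h hBA) :=
  ((continuous_indicator_coord B).comp continuous_subtype_val).subtype_mk _

theorem CoordImage.proj_toCoordImage (hBA : B ⊆ A) (x : X) :
    CoordImage.proj h hBA (toCoordImage h A x) = toCoordImage h B x :=
  Subtype.ext (by
    simp [CoordImage.proj, toCoordImage, indicator_indicator, inter_eq_left.2 hBA])

theorem toCoordImage_eq_iff {x y : X} :
    toCoordImage h A x = toCoordImage h A y ↔ EqOn (h x) (h y) A := by
  rw [Subtype.ext_iff]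
  constructor
  · intro H a ha
    simpa [toCoordImage, ha] using congrFun H a
  · intro H
    ext a
    by_cases ha : a ∈ A
    · simp [toCoordImage, ha, H ha]
    · simp [toCoordImage, ha]

/-- The inverse system of the images of `h` belonging to an increasing family of coordinate sets. -/
noncomputable def coordSystem (h : X → κ → unitInterval) {ι : Type u} [Preorder ι] (B : ι → Set κ)
    (hB : Monotone B) : TopInverseSystem.{u, u} ι where
  space i := CoordImage h (B i)
  bond _ _ hij := CoordImage.proj h (hB hij)
  continuous_bond _ _ hij := CoordImage.continuous_proj (hB hij)
  bond_self i y := by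
    obtain ⟨x, rfl⟩ := toCoordImage_surjective y
    exact CoordImage.proj_toCoordImage _ x
  bond_bond i j k hij hjk y := by
    obtain ⟨x, rfl⟩ := toCoordImage_surjective y
    simp only [CoordImage.proj_toCoordImage]

variable [TopologicalSpace X]

theorem continuous_toCoordImage (hh : Continuous h) : Continuous (toCoordImage h A) :=
  ((continuous_indicator_coord A).comp hh).subtype_mk _

theorem compactSpace_coordImage [CompactSpace X] (hh : Continuous h) :
    CompactSpace (CoordImage h A) :=
  isCompact_iff_compactSpace.1 (isCompact_range ((continuous_indicator_coord A).comp hh))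

/-- If the map onto the smaller image is a retraction, so is the projection. -/
theorem CoordImage.isRetractionMap_proj (hh : Continuous h) (hBA : B ⊆ A)
    (hB : IsRetractionMap (toCoordImage h B)) : IsRetractionMap (CoordImage.proj h hBA) := by
  obtain ⟨-, s, hs, hs'⟩ := hB
  exact ⟨CoordImage.continuous_proj hBA, toCoordImage h A ∘ s,
    (continuous_toCoordImage hh).comp hs, fun y => by
      rw [Function.comp_apply, CoordImage.proj_toCoordImage, hs']⟩

/-- Coordinates outside `A` vanish, so by compactness restriction to `A` embeds the image in a
countable power of the interval. -/
theorem CoordImage.metrizableSpace_of_countable [CompactSpace X] (hh : Continuous h)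
    (hA : A.Countable) : TopologicalSpace.MetrizableSpace (CoordImage h A) := by
  have := compactSpace_coordImage (A := A) hh
  have := hA.to_subtype
  have hc : Continuous fun (y : CoordImage h A) (a : A) => y.1 a :=
    continuous_pi fun a => (continuous_apply a.1).comp continuous_subtype_val
  refine (hc.isClosedEmbedding ?_).isEmbedding.metrizableSpace
  intro y z hyz
  obtain ⟨x, rfl⟩ := toCoordImage_surjective y
  obtain ⟨x', rfl⟩ := toCoordImage_surjective z
  refine toCoordImage_eq_iff.2 fun a ha => ?_
  simpa [toCoordImage, ha] using congrFun hyz ⟨a, ha⟩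

/-- The image belonging to a directed union of coordinate sets is the limit of the images belonging
to the members of the family. -/
theorem isLimitCone_coordSystem [CompactSpace X] (hh : Continuous h) {ι : Type u} [LinearOrder ι]
    [Nonempty ι] (B : ι → Set κ) (hB : Monotone B) (hsub : ∀ i, B i ⊆ A) (hA : A ⊆ ⋃ i, B i) :
    (coordSystem h B hB).IsLimitCone
      (X := CoordImage h A) fun i => CoordImage.proj h (hsub i) := by
  have hp : ∀ ⦃i j : ι⦄ (hij : i ≤ j) (y : CoordImage h A), CoordImage.proj h (hB hij)
      (CoordImage.proj h (hsub j) y) = CoordImage.proj h (hsub i) y := by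
    intro i j hij y
    obtain ⟨x, rfl⟩ := toCoordImage_surjective y
    simp only [CoordImage.proj_toCoordImage]
  refine ⟨hp, ?_⟩
  have := compactSpace_coordImage (A := A) hh
  have : T2Space (coordSystem h B hB).Limit :=
    inferInstanceAs (T2Space {x : ∀ i, CoordImage h (B i) //
      ∀ ⦃i j : ι⦄ (hij : i ≤ j), CoordImage.proj h (hB hij) (x j) = x i})
  rw [isHomeomorph_iff_continuous_bijective]
  refine ⟨(continuous_pi fun i => CoordImage.continuous_proj (hsub i)).subtype_mk _, ?_, ?_⟩
  · intro y z hyz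
    obtain ⟨x, rfl⟩ := toCoordImage_surjective y
    obtain ⟨x', rfl⟩ := toCoordImage_surjective z
    refine toCoordImage_eq_iff.2 fun a ha => ?_
    obtain ⟨i, hi⟩ := mem_iUnion.1 (hA ha)
    have H : CoordImage.proj h (hsub i) (toCoordImage h A x) =
        CoordImage.proj h (hsub i) (toCoordImage h A x') := congrFun (congrArg Subtype.val hyz) i
    rw [CoordImage.proj_toCoordImage, CoordImage.proj_toCoordImage] at H
    exact toCoordImage_eq_iff.1 H hi
  -- The fibres over the entries of a thread are nonempty, closed and decreasing in the compact
  -- space `X`; any common point maps to the thread.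
  · rintro ⟨y, hy⟩
    let T : ι → Set X := fun i => toCoordImage h (B i) ⁻¹' {y i}
    have hclosed : ∀ i, IsClosed (T i) := fun i =>
      isClosed_singleton.preimage (continuous_toCoordImage hh)
    have hdir : Directed (· ⊇ ·) T := directed_of_isDirected_le fun i j hij x hx => by
      have hx' : toCoordImage h (B j) x = y j := hx
      change toCoordImage h (B i) x = y i
      rw [← CoordImage.proj_toCoordImage (hB hij), hx']
      exact hy hij
    obtain ⟨x, hx⟩ := IsCompact.nonempty_iInter_of_directed_nonempty_isCompact_isClosed T hdir
      (fun i => toCoordImage_surjective (y i)) (fun i => (hclosed i).isCompact) hclosed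
    refine ⟨toCoordImage h A x, Subtype.ext (funext fun i => ?_)⟩
    exact (CoordImage.proj_toCoordImage (hsub i) x).trans (mem_iInter.1 hx i)

end CoordinateRestriction

/-! ### Membership in class `R` by induction on cardinality -/

/-- Class `R` is invariant under homeomorphisms. -/
theorem IsClassR.of_isHomeomorph {X Z : Type u} [TopologicalSpace X] [TopologicalSpace Z]
    (hX : IsClassR X) {φ : Z → X} (hφ : IsHomeomorph φ) : IsClassR Z := by
  -- A sequence of length one has no limit index, and its limit is determined only up to
  -- homeomorphism.
  let S : TopInverseSystem.{u, u} PUnit.{u + 1} :=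
    { space := fun _ => X
      bond := fun _ _ _ => id
      continuous_bond := fun _ _ _ => continuous_id
      bond_self := fun _ _ => rfl
      bond_bond := fun _ _ _ _ _ _ => rfl }
  refine IsClassR.of_limit PUnit S (fun δ hδ => (hδ.1 fun _ _ => le_rfl).elim)
    (fun _ _ _ => ⟨continuous_id, id, continuous_id, fun _ => rfl⟩) (fun _ => hX) Z (fun _ => φ)
    ⟨fun _ _ _ _ => rfl, ?_⟩
  let ψ : X ≃ₜ S.Limit :=
    { toFun := fun x => ⟨fun _ => x, fun _ _ _ => rfl⟩
      invFun := fun y => y.1 PUnit.unit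
      left_inv := fun _ => rfl
      right_inv := fun _ => rfl
      continuous_toFun := (continuous_pi fun _ => continuous_id).subtype_mk _
      continuous_invFun := (continuous_apply PUnit.unit).comp continuous_subtype_val }
  exact ψ.isHomeomorph.comp hφ

/-- If the maps onto all images belonging to `C`-closed sets of coordinates are retractions, then
these images belong to class `R`. -/
theorem isClassR_coordImage {κ X : Type u} [TopologicalSpace X] [CompactSpace X]
    {h : X → κ → unitInterval} (hh : Continuous h) {C : Finset κ → Set κ}
    (hC : ∀ F, (C F).Countable)
    (hretr : ∀ A, IsFinClosed C A → IsRetractionMap (toCoordImage h A)) (A : Set κ)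
    (hA : IsFinClosed C A) : IsClassR (CoordImage h A) := by
  induction hc : #A using WellFoundedLT.induction generalizing A with
  | ind c ih =>
  subst hc
  have := compactSpace_coordImage (A := A) hh
  rcases le_or_gt #A ℵ₀ with hcount | hunc
  · have := CoordImage.metrizableSpace_of_countable hh (le_aleph0_iff_set_countable.1 hcount)
    exact IsClassR.of_metrizable _
  -- In this order type every proper initial segment has fewer than `#A` elements. Closing it may
  -- add countably many points to a finite set, which is harmless since `A` is uncountable.
  let ι := (#A).ord.ToType
  obtain ⟨σ⟩ : Nonempty (ι ≃ A) := Cardinal.eq.1 (mk_ord_toType #A)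
  let P : ι → Set κ := fun i => (fun j => (σ j : κ)) '' Iio i
  let B : ι → Set κ := fun i => finClosure C (P i)
  have hP : Monotone P := fun i j hij => image_mono (Iio_subset_Iio hij)
  have hB : Monotone B := fun i j hij => finClosure_mono (hP hij)
  have hBc : ∀ i, IsFinClosed C (B i) := fun i => isFinClosed_finClosure C _
  have hBA : ∀ i, B i ⊆ A := fun i => finClosure_subset hA (by
    rintro _ ⟨j, -, rfl⟩
    exact (σ j).2)
  have hBcard : ∀ i, #(B i) < #A := fun i => by
    refine (mk_finClosure_le hC (le_max_right #(P i) ℵ₀) (le_max_left _ _)).trans_lt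
      (max_lt ?_ hunc)
    exact mk_image_le.trans_lt ((mk_Iio_lt i (by simp [ι])).trans_eq (mk_ord_toType _))
  have : NoMaxOrder ι := Cardinal.noMaxOrder hunc.le
  have : Nonempty ι := by
    rw [← mk_ne_zero_iff, mk_ord_toType]
    exact (aleph0_pos.trans hunc).ne'
  refine IsClassR.of_limit ι (coordSystem h B hB) ?_
    (fun i j hij => CoordImage.isRetractionMap_proj hh (hB hij) (hretr _ (hBc i)))
    (fun i => ih _ (hBcard i) (B i) (hBc i) rfl) _ _
    (isLimitCone_coordSystem hh B hB hBA ?_)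
  · intro δ hδ
    have : Nonempty (Iio δ) := by
      obtain ⟨i, hi⟩ := not_isMin_iff.1 hδ.1
      exact ⟨⟨i, hi⟩⟩
    refine isLimitCone_coordSystem hh (fun i : Iio δ => B i) (fun i j hij => hB hij)
      (fun i => hB i.2.le) ?_
    -- The union of the earlier sets is closed, so it suffices that it contains `P δ`. As `P k`
    -- omits `σ k`, an index strictly between `j` and `δ` is needed.
    refine finClosure_subset (IsFinClosed.iUnion_of_directed
      (Monotone.directed_le fun i j hij => hB hij) fun i => hBc i) ?_
    rintro _ ⟨j, hj, rfl⟩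
    obtain ⟨k, hjk, hkδ⟩ : ∃ k, j < k ∧ k < δ := by
      by_contra! H
      exact hδ.2 j ⟨hj, fun k hjk hkδ => (H k hjk).not_gt hkδ⟩
    exact mem_iUnion.2 ⟨⟨k, hkδ⟩, subset_finClosure ⟨j, hjk, rfl⟩⟩
  · intro a ha
    obtain ⟨j, hj⟩ := exists_gt (σ.symm ⟨a, ha⟩)
    exact mem_iUnion.2 ⟨j, subset_finClosure ⟨_, hj, by simp⟩⟩

/-! ### Countable dependence and density of the `Σ`-product -/

/-- A continuous map from a compact subspace of a product into a metric space depends on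
countably many coordinates. -/
theorem exists_countable_dependsOn {κ Y : Type*} {Z : κ → Type*} {W : Type*} [TopologicalSpace Y]
    [CompactSpace Y] [∀ a, TopologicalSpace (Z a)] [∀ a, T2Space (Z a)] [MetricSpace W]
    {e : Y → ∀ a, Z a} (he : Continuous e) (hinj : Function.Injective e) {ψ : Y → W}
    (hψ : Continuous ψ) :
    ∃ D : Set κ, D.Countable ∧ ∀ y z, (∀ a ∈ D, e y a = e z a) → ψ y = ψ z := by
  -- Pairs with values at least `1/(n+1)` apart form a compact set off the diagonal, so finitely
  -- many coordinates separate them all.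
  let W' : ℕ → Set (Y × Y) := fun n => {p | 1 / ((n : ℝ) + 1) ≤ dist (ψ p.1) (ψ p.2)}
  have hW : ∀ n, IsCompact (W' n) := fun n => (isClosed_le continuous_const
    ((hψ.comp continuous_fst).dist (hψ.comp continuous_snd))).isCompact
  have hF : ∀ n, ∃ F : Finset κ, W' n ⊆ ⋃ a ∈ F, {p : Y × Y | e p.1 a ≠ e p.2 a} := fun n => by
    refine (hW n).elim_finite_subcover _ (fun a => isOpen_ne_fun
      ((continuous_apply a).comp (he.comp continuous_fst))
      ((continuous_apply a).comp (he.comp continuous_snd))) fun p hp => ?_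
    by_contra H
    simp only [mem_iUnion, mem_ofPred_eq, not_exists, not_not] at H
    have hp' : 1 / ((n : ℝ) + 1) ≤ dist (ψ p.1) (ψ p.2) := hp
    rw [hinj (funext H), dist_self] at hp'
    exact absurd hp' (not_le.2 Nat.one_div_pos_of_nat)
  choose F hF using hF
  refine ⟨⋃ n, F n, countable_iUnion fun n => (F n).countable_toSet, fun y z hyz => ?_⟩
  by_contra hne
  obtain ⟨n, hn⟩ := exists_nat_one_div_lt (dist_pos.2 hne)
  have := hF n (show (y, z) ∈ W' n from hn.le)
  simp only [mem_iUnion, mem_ofPred_eq] at this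
  obtain ⟨a, ha, hne'⟩ := this
  exact hne' (hyz a (mem_iUnion.2 ⟨n, ha⟩))

/-- For every map `p` into a separable metrizable space, each subset `D` of the domain has a countable
subset whose image is dense in the image of `D`. -/
theorem exists_countable_subset_image_dense {Z W : Type*} [TopologicalSpace W]
    [TopologicalSpace.PseudoMetrizableSpace W] [SecondCountableTopology W] (p : Z → W) (D : Set Z) :
    ∃ E ⊆ D, E.Countable ∧ p '' D ⊆ closure (p '' E) := by
  obtain ⟨t, htD, ht, hd⟩ := (TopologicalSpace.IsSeparable.of_separableSpace
    (p '' D)).exists_countable_dense_subset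
  have := ht.to_subtype
  choose s hsD hs using fun w : t => htD w.2
  refine ⟨range s, range_subset_iff.2 hsD, countable_range s, hd.trans (closure_mono fun w hw => ?_)⟩
  exact ⟨s ⟨w, hw⟩, mem_range_self _, hs ⟨w, hw⟩⟩

/-- In a compact set in which the `Σ`-product is dense there is a finitary operation with countable
values such that the set is invariant under the restriction to closed sets of coordinates. -/
theorem exists_finClosed_indicator_mem {κ : Type u} {K : Set (κ → unitInterval)}
    (hK : K = closure (K ∩ sigmaProduct κ)) :
    ∃ C : Finset κ → Set κ, (∀ F, (C F).Countable) ∧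
      ∀ A, IsFinClosed C A → ∀ x ∈ K, A.indicator x ∈ K := by
  classical
  have h := fun F : Finset κ => exists_countable_subset_image_dense
    (fun (x : κ → unitInterval) (a : F) => x a) (K ∩ sigmaProduct κ)
  choose E hE hEc hEd using h
  refine ⟨fun F => ⋃ d ∈ E F, {a | d a ≠ 0}, fun F => (hEc F).biUnion fun d hd => (hE F hd).2,
    fun A hA x hx => ?_⟩
  have hcl : IsClosed K := by
    rw [hK]
    exact isClosed_closure
  rw [← hcl.closure_eq, mem_closure_iff]
  intro o ho hxo
  obtain ⟨I, v, hv, hvo⟩ := isOpen_pi_iff.1 ho _ hxo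
  -- A point `d ∈ E F` close to `x` on `F` has support in `C F ⊆ A`, so it also agrees with the
  -- restricted point on `I \ A`, where both vanish.
  let F : Finset κ := I.filter (· ∈ A)
  have hFA : (F : Set κ) ⊆ A := fun a ha => (Finset.mem_filter.1 ha).2
  have hFI : ∀ a ∈ F, a ∈ I := fun a ha => (Finset.mem_filter.1 ha).1
  let p : (κ → unitInterval) → F → unitInterval := fun x a => x a
  have hp : Continuous p := continuous_pi fun a => continuous_apply a.1
  have hpx : p x ∈ closure (p '' E F) := by
    rw [hK] at hx
    exact closure_minimal (hEd F) isClosed_closure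
      (image_closure_subset_closure_image hp ⟨x, hx, rfl⟩)
  have hV : IsOpen (univ.pi fun a : F => v a) :=
    isOpen_set_pi finite_univ fun a _ => (hv a (hFI a a.2)).1
  obtain ⟨_, hdV, d, hd, rfl⟩ := mem_closure_iff.1 hpx _ hV fun a _ => by
    simpa [hFA a.2] using (hv a (hFI a a.2)).2
  refine ⟨d, hvo fun a ha => ?_, (hE F hd).1⟩
  by_cases haA : a ∈ A
  · exact hdV ⟨a, Finset.mem_filter.2 ⟨ha, haA⟩⟩ (mem_univ _)
  · have hda : d a = 0 := by
      by_contra hne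
      exact haA (hA F hFA (mem_biUnion hd hne))
    simpa [haA, hda] using (hv a ha).2

/-! ### The main theorem -/

/-- A retract of a Valdivia compact space belongs to class `R`. -/
theorem mainTheorem3 (Y : Type u) [TopologicalSpace Y] (hY : IsValdiviaCompact Y)
    (X : Type u) [TopologicalSpace X] (f : Y → X) (hf : IsRetractionMap f) :
    IsClassR X := by
  obtain ⟨hYc, κ, e, he, hdense⟩ := hY
  obtain ⟨hfc, g, hg, hfg⟩ := hf
  have hX : CompactSpace X := ⟨by
    rw [← (show Function.Surjective f from fun x => ⟨g x, hfg x⟩).range_eq]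
    exact isCompact_range hfc⟩
  let h : X → κ → unitInterval := e ∘ g
  have hh : Continuous h := he.continuous.comp hg
  have hinj : Function.Injective h := he.injective.comp (Function.LeftInverse.injective hfg)
  have hdep := fun a => exists_countable_dependsOn he.continuous he.injective
    ((continuous_apply a).comp (hh.comp hfc))
  choose D hDc hD using hdep
  obtain ⟨C, hCc, hC⟩ := exists_finClosed_indicator_mem hdense
  let C' : Finset κ → Set κ := fun F => C F ∪ ⋃ a ∈ F, D a
  have hC'c : ∀ F, (C' F).Countable := fun F =>
    (hCc F).union (F.countable_toSet.biUnion fun a _ => hDc a)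
  have hretr : ∀ A, IsFinClosed C' A → IsRetractionMap (toCoordImage h A) := by
    intro A hA
    have hAC : IsFinClosed C A := fun F hF => subset_union_left.trans (hA F hF)
    have hAD : ∀ a ∈ A, D a ⊆ A := fun a ha b hb =>
      hA {a} (by simpa using ha) (Or.inr (by simpa using hb))
    have hmem : ∀ y : CoordImage h A, y.1 ∈ range e := by
      rintro ⟨_, x, rfl⟩
      exact hC A hAC _ ⟨g x, rfl⟩
    refine ⟨continuous_toCoordImage hh, fun y => f (he.toHomeomorph.symm ⟨y.1, hmem y⟩),
      hfc.comp (he.toHomeomorph.symm.continuous.comp (continuous_subtype_val.subtype_mk _)),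
      fun y => ?_⟩
    obtain ⟨x, rfl⟩ := toCoordImage_surjective y
    refine toCoordImage_eq_iff.2 fun a ha => ?_
    set z := he.toHomeomorph.symm ⟨(toCoordImage h A x).1, hmem _⟩ with hz
    have hez : e z = A.indicator (h x) :=
      congrArg Subtype.val (he.toHomeomorph.apply_symm_apply ⟨(toCoordImage h A x).1, hmem _⟩)
    -- On `D a ⊆ A` the points `e z` and `e (g x)` agree, so `f z` and `f (g x) = x` have the same
    -- `a`-th coordinate under `h`.
    have := hD a z (g x) fun b hb => by
      rw [hez, indicator_of_mem (hAD a ha hb)]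
      rfl
    simpa [hfg] using this
  have hR := isClassR_coordImage hh hC'c hretr univ fun F _ => subset_univ _
  refine hR.of_isHomeomorph (φ := toCoordImage h univ) ?_
  rw [isHomeomorph_iff_continuous_bijective]
  exact ⟨continuous_toCoordImage hh, fun x y hxy => hinj (funext fun a =>
    toCoordImage_eq_iff.1 hxy (mem_univ a)), toCoordImage_surjective⟩
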